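/- Let $G$ be a path on $k\ge 1$ vertices, with vertex set $V$ and edge set $E$. Choose an orientation of each edge and let $E'\subseteq V\times V$ be the set of oriented edges. Let $\mathcal A_G$ be the automaton with alphabet $V$ and state set $E'\cup\{id\}$, where $id$ is a sink acting trivially, and where a state $e=(x,y)\in E'$ has output map $\eta(e,x)=y$, $\eta(e,y)=x$, $\eta(e,z)=z$ for $z\ne x,y$, and restriction map $\lambda(e,x)=e$, $\lambda(e,z)=id$ for $z\neq x$. The states act on words over $V$ by $\eta(q,zw)=\eta(q,z)\,\eta(\lambda(q,z),w)$. For $n\ge 1$ let $\Gamma_n^G$ be the $n$-th Schreier graph: its vertices are the words of length $n$ over $V$, and $u,v$ are joined by an edge whenever $\eta(q,u)=v$ for some state $q$ (edges are regarded as undirected; loops and multiple edges do not affect distances). The Wiener index $W(\Gamma)$ of a finite connected graph $\Gamma$ is the sum of the distances over all unordered pairs of vertices, $W(\Gamma)=\frac12\sum_{u}\sum_{v} d_\Gamma(u,v)$. Then, for every $n\ge 1$ and every choice of the orientation, $\Gamma_n^G$ is connected and $$ \begin{aligned} W(\Gamma_n^G) ={}& \frac{(k-1)^2(2k^2-2k-1)}{k^3(2k-1)}\cdot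 2^n k^{2n} + \frac{(k-1)(k-2)(k-3)}{3k^2}\cdot n k^{2n}\\ &- \frac{(k+1)(k-2)(k^2+2k-6)}{6k^3}\cdot k^{2n} + \frac{(k+1)(k-2)(2k-5)}{6k(2k-1)}\cdot k^n . \end{aligned} $$ -/

import Mathlib

namespace GraphAutomaton

/-- An automaton (transducer) with state set `Q` and alphabet `X`: `restr` is the restriction map
`λ` and `out` is the output map `η`. -/
structure Automaton (Q X : Type*) where
  restr : Q → X → Q
  out : Q → X → X

/-- The action of a state on words of length `n`, read from the first letter:
`η(q, x w) = η(q, x) η(λ(q, x), w)`. -/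
def Automaton.act {Q X : Type*} (A : Automaton Q X) : {n : ℕ} → Q → (Fin n → X) → (Fin n → X)
  | 0, _, w => w
  | _ + 1, q, w => Fin.cons (A.out q (w 0)) (A.act (A.restr q (w 0)) (Fin.tail w))

/-- The `n`-th Schreier graph: the vertices are the words of length `n`, and `u`, `v` are adjacent
when some state maps one of them to the other. Loops and repeated edges are not recorded, since they
do not affect distances. -/
def Automaton.schreierGraph {Q X : Type*} (A : Automaton Q X) (n : ℕ) : SimpleGraph (Fin n → X) :=
  SimpleGraph.fromRel fun u v => ∃ q : Q, A.act q u = v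

/-- An orientation of the edges of `G`: a set of ordered pairs containing, for each edge `{x, y}`,
exactly one of `(x, y)` and `(y, x)`, and nothing else. -/
structure EdgeOrientation {V : Type*} (G : SimpleGraph V) where
  arcs : Set (V × V)
  adj_of_mem : ∀ {x y : V}, (x, y) ∈ arcs → G.Adj x y
  xor_of_adj : ∀ {x y : V}, G.Adj x y → Xor ((x, y) ∈ arcs) ((y, x) ∈ arcs)

open Classical in
/-- The graph automaton of `G` for the chosen orientation. The states are the oriented edges together
with the sink `none`; the oriented edge `(x, y)` exchanges the letters `x` and `y`, restricts to
itself at `x` and to the sink at every other letter. -/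
noncomputable def graphAutomaton {V : Type*} {G : SimpleGraph V} (o : EdgeOrientation G) :
    Automaton (Option o.arcs) V where
  restr
    | none, _ => none
    | some e, z => if z = e.1.1 then some e else none
  out
    | none, z => z
    | some e, z => if z = e.1.1 then e.1.2 else if z = e.1.2 then e.1.1 else z

/-- The total distance of `v`: the sum of the distances of all vertices from `v`. -/
noncomputable def totalDist {V : Type*} [Fintype V] (G : SimpleGraph V) (v : V) : ℕ :=
  ∑ u, G.dist v u

/-- The Wiener index: the sum of the distances over all unordered pairs of vertices, that is, half
of the sum of the total distances of all vertices. -/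
noncomputable def wienerIndex {V : Type*} [Fintype V] (G : SimpleGraph V) : ℚ :=
  (1 / 2 : ℚ) * ∑ v, (totalDist G v : ℚ)

end GraphAutomaton

namespace GraphAutomaton

/-! ### Words and odometers -/

/-! Number the letters along the path, so that the edge `i : Fin m` joins the letters `i` and `i +
1`, with `k = m + 1`. Its generator is a binary odometer on words over these two letters, and its
orbits are cycles. The Schreier graph is a cactus, a tree of such cycles, so a distance is the sum,
over all cycles, of the distances between the projections of the two words.

Appending a last letter `a` gives `k` copies of the graph one level down. In copy `a` every cycle is
frozen, except that the big cycles (words written with the two ends of one edge) of the edges at `a`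
are cut open and glued to those of the neighbouring copy, which doubles their length. The big cycles
form a chain whose joints are constant words. Hence the projections can be defined by recursion on
the last letter (`pos`, `small`), without describing the cactus.

That the resulting function `total` is the distance follows from `connected_and_dist_eq`: it changes
by at most 1 along an edge (`Joined.total_le`), and from `v ≠ u` some edge lowers it
(`exists_joined_total`).

For the Wiener index, `total` is summed over all pairs. Antipodal points of a cycle of length `2 * 2
^ n` have distances to any third point adding up to `2 ^ n`, so the big cycles are summed exactly
(`sum_big`). The frozen cycles obey linear recurrences (`rootSum_succ`, `smallSum_succ`), which the
closed form solves. -/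

/-- The word without its last letter. -/
def front {X : Type*} {n : ℕ} (w : Fin (n + 1) → X) : Fin n → X := fun j => w j.castSucc

/-- The word `w a`. -/
def append {X : Type*} {n : ℕ} (w : Fin n → X) (a : X) : Fin (n + 1) → X :=
  Fin.snoc (α := fun _ => X) w a

@[simp] lemma front_append {X : Type*} {n : ℕ} (w : Fin n → X) (a : X) :
    front (append w a) = w := by
  funext j; simp [front, append]

@[simp] lemma append_last {X : Type*} {n : ℕ} (w : Fin n → X) (a : X) :
    append w a (Fin.last n) = a := by
  simp [append]

@[simp] lemma append_front_last {X : Type*} {n : ℕ} (w : Fin (n + 1) → X) :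
    append (front w) (w (Fin.last n)) = w :=
  Fin.snoc_init_self w

lemma word_ext {X : Type*} {n : ℕ} {u v : Fin (n + 1) → X} (h : front u = front v)
    (hl : u (Fin.last n) = v (Fin.last n)) : u = v := by
  rw [← append_front_last u, ← append_front_last v, h, hl]

@[simp] lemma front_const {X : Type*} {n : ℕ} (a : X) :
    front (fun _ : Fin (n + 1) => a) = fun _ => a := rfl

lemma forall_word {X : Type*} {n : ℕ} (w : Fin (n + 1) → X) (p : X → Prop) :
    (∀ t, p (w t)) ↔ (∀ t, p (front w t)) ∧ p (w (Fin.last n)) := by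
  rw [Fin.forall_fin_succ']; rfl

lemma sum_word {X : Type*} [Fintype X] {n : ℕ} (f : (Fin (n + 1) → X) → ℤ) :
    ∑ u, f u = ∑ w : Fin n → X, ∑ a, f (append w a) := by
  rw [← Fintype.sum_prod_type']
  refine Fintype.sum_equiv ⟨fun u => (front u, u (Fin.last n)), fun p => append p.1 p.2,
    fun u => by simp, fun p => by simp⟩ _ _ fun u => by simp

section Odometer

variable {X : Type*} [DecidableEq X]

/-- The odometer that exchanges `x` and `y`, with carry at `x`. -/
def odo (x y : X) {n : ℕ} (w : Fin n → X) : Fin n → X :=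
  fun j => if ∀ i < j, w i = x then Equiv.swap x y (w j) else w j

lemma front_odo (x y : X) {n : ℕ} (w : Fin (n + 1) → X) :
    front (odo x y w) = odo x y (front w) := by
  funext j
  have : (∀ i < j.castSucc, w i = x) ↔ ∀ i < j, w i.castSucc = x := by
    constructor
    · intro h i hi
      exact h _ (by simpa using hi)
    · intro h i hi
      have := h ⟨i, lt_trans hi j.2⟩ hi
      simpa using this
  simp only [front, odo, this]
  congr

lemma odo_last (x y : X) {n : ℕ} (w : Fin (n + 1) → X) :
    odo x y w (Fin.last n) =
      if front w = (fun _ => x) then Equiv.swap x y (w (Fin.last n)) else w (Fin.last n) := by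
  have : (∀ i < Fin.last n, w i = x) ↔ front w = fun _ => x := by
    constructor
    · intro h
      funext i
      exact h _ (Fin.castSucc_lt_last i)
    · intro h i hi
      have := congrFun h ⟨i, hi⟩
      simpa [front] using this
  simp [odo, this]

/-- The carry reaches the last letter of `w` when the prefix is constantly `x`, which is exactly
when the image prefix is constantly `y`. Thus reversing an arc inverts its generator, and the
orientation does not affect the graph. -/
lemma odo_odo (x y : X) {n : ℕ} (w : Fin n → X) : odo y x (odo x y w) = w := by
  induction n with
  | zero => exact Subsingleton.elim _ _
  | succ n ih =>
    have hc : odo x y (front w) = (fun _ => y) ↔ front w = fun _ => x := by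
      constructor
      · intro h
        rw [← ih (front w), h]
        funext j
        simp [odo]
      · intro h
        rw [h]
        funext j
        simp [odo]
    apply word_ext
    · rw [front_odo, front_odo, ih]
    · rw [odo_last, front_odo, odo_last]
      simp only [hc]
      split_ifs
      · rw [Equiv.swap_comm y x]; simp
      · rfl

lemma odo_const (x y : X) (n : ℕ) : odo x y (fun _ : Fin n => x) = fun _ => y := by
  funext j; simp [odo]

lemma odo_comp {Y : Type*} [DecidableEq Y] (f : X ≃ Y) (x y : X) {n : ℕ} (w : Fin n → X) :
    odo (f x) (f y) (f ∘ w) = f ∘ odo x y w := by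
  funext j
  simp only [odo, Function.comp, EmbeddingLike.apply_eq_iff_eq]
  split_ifs
  · simp [Equiv.swap_apply_def, apply_ite f]
  · rfl

end Odometer

/-! ### The states of the automaton act as odometers. -/

section Action

variable {V : Type*} {G : SimpleGraph V}

lemma act_none (o : EdgeOrientation G) {n : ℕ} (w : Fin n → V) :
    (graphAutomaton o).act none w = w := by
  induction n with
  | zero => rfl
  | succ n ih =>
    simp only [Automaton.act, graphAutomaton] at ih ⊢
    rw [ih]
    exact Fin.cons_self_tail w

lemma act_some [DecidableEq V] (o : EdgeOrientation G) (e : o.arcs) {n : ℕ} (w : Fin n → V) :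
    (graphAutomaton o).act (some e) w = odo e.1.1 e.1.2 w := by
  induction n with
  | zero => exact Subsingleton.elim _ _
  | succ n ih =>
    rw [Automaton.act]
    funext j
    refine Fin.cases ?_ (fun j => ?_) j
    · rw [Fin.cons_zero]
      simp only [graphAutomaton, odo, Equiv.swap_apply_def, Fin.not_lt_zero, IsEmpty.forall_iff,
        implies_true, if_true]
      split_ifs <;> rfl
    · rw [Fin.cons_succ]
      by_cases h : w 0 = e.1.1
      · have hr : (graphAutomaton o).restr (some e) (w 0) = some e := by
          simp [graphAutomaton, h]
        rw [hr, ih]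
        simp only [odo, Fin.forall_fin_succ, h, Fin.tail, Fin.succ_pos, Fin.succ_lt_succ_iff,
          forall_const, true_and]
        congr
      · have hr : (graphAutomaton o).restr (some e) (w 0) = none := by
          simp [graphAutomaton, h]
        rw [hr, act_none]
        simp [odo, Fin.forall_fin_succ, h, Fin.tail]

end Action

/-! ### A criterion for distances -/

/-- Repeated descent from `v` produces a walk to `u` of length `D u v`; the Lipschitz bound `hl`
shows that no walk is shorter. -/
lemma connected_and_dist_eq {W : Type*} [Nonempty W] (Γ : SimpleGraph W) (D : W → W → ℤ)
    (h0 : ∀ u, D u u = 0) (hnn : ∀ u v, 0 ≤ D u v)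
    (hl : ∀ u v v', Γ.Adj v v' → D u v' ≤ D u v + 1)
    (hd : ∀ u v, u ≠ v → ∃ v', Γ.Adj v v' ∧ D u v' + 1 = D u v) :
    Γ.Connected ∧ ∀ u v, (Γ.dist u v : ℤ) = D u v := by
  have key : ∀ (N : ℕ) (u v : W), D u v = N → ∃ p : Γ.Walk v u, p.length = N := by
    intro N
    induction N with
    | zero =>
      intro u v h
      by_cases huv : u = v
      · subst huv; exact ⟨.nil, rfl⟩
      · obtain ⟨v', -, h'⟩ := hd u v huv
        have := hnn u v'
        push_cast at h
        omega
    | succ N ih =>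
      intro u v h
      have huv : u ≠ v := by
        rintro rfl
        rw [h0] at h
        push_cast at h
        omega
      obtain ⟨v', ha, h'⟩ := hd u v huv
      obtain ⟨p, hp⟩ := ih u v' (by push_cast at h; omega)
      exact ⟨.cons ha p, by simp [hp]⟩
  have low : ∀ (u v w : W) (p : Γ.Walk v w), D u w ≤ D u v + p.length := by
    intro u v w p
    induction p with
    | nil => simp
    | cons ha p ih =>
      have := hl u _ _ ha
      simp only [SimpleGraph.Walk.length_cons]
      push_cast
      omega
  have hwalk : ∀ u v, ∃ p : Γ.Walk v u, (p.length : ℤ) = D u v := by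
    intro u v
    obtain ⟨p, hp⟩ := key (D u v).toNat u v (by rw [Int.toNat_of_nonneg (hnn u v)])
    exact ⟨p, by rw [hp, Int.toNat_of_nonneg (hnn u v)]⟩
  have hc : Γ.Connected := ⟨fun u v => (hwalk v u).choose.reachable⟩
  refine ⟨hc, fun u v => ?_⟩
  obtain ⟨p, hp⟩ := hwalk u v
  obtain ⟨q, hq⟩ := hc.exists_walk_length_eq_dist u v
  have h1 := SimpleGraph.dist_le p
  rw [SimpleGraph.dist_comm] at h1
  have h2 := low u u v q
  rw [h0, hq] at h2
  omega


/-! ### The big cycles -/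

/-- The distance of `s` and `t` on a cycle of length `M`. -/
def cyc (M s t : ℤ) : ℤ := min |s - t| (M - |s - t|)

lemma cyc_eq (M s t : ℤ) : cyc M s t =
    if t ≤ s then (if 2 * (s - t) ≤ M then s - t else M - (s - t))
    else (if 2 * (t - s) ≤ M then t - s else M - (t - s)) := by
  unfold cyc
  rcases le_or_gt t s with h | h
  · rw [abs_of_nonneg (by omega), if_pos h]
    split_ifs <;> omega
  · rw [abs_of_neg (by omega), if_neg (by omega)]
    split_ifs <;> omega

lemma cyc_comm (M s t : ℤ) : cyc M s t = cyc M t s := by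
  unfold cyc; rw [abs_sub_comm]

section BigCycle

variable {m : ℕ}

/-- The letter `a` is an end of the edge `i`. -/
def Inc (i : Fin m) (a : Fin (m + 1)) : Prop := a.val = i ∨ a.val = i + 1

instance (i : Fin m) (a : Fin (m + 1)) : Decidable (Inc i a) := by unfold Inc; infer_instance

/-- The word `w` lies on the big cycle of the edge `i`. -/
def On (i : Fin m) {n : ℕ} (w : Fin n → Fin (m + 1)) : Prop := ∀ t, Inc i (w t)

/-- The projection of a word to the big cycle of the edge `i`. -/
def pos (i : Fin m) : {n : ℕ} → (Fin n → Fin (m + 1)) → ℤ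
  | 0, _ => 0
  | n + 1, u =>
    if (u (Fin.last n)).val = i then pos i (front u) + 2 ^ n
    else if (u (Fin.last n)).val = i + 1 then pos i (front u)
    else if (u (Fin.last n)).val < i then 2 ^ (n + 1) - 1 else 0

/-- Position `0` is the constant word `i + 1` and the top position is the constant word `i`. These
are the joints with the rest of the chain, so copies with a letter above or below the edge project
entirely to one of them. The copies `i + 1` and `i` contribute the lower and upper halves of the
doubled cycle. -/
lemma pos_succ (i : Fin m) {n : ℕ} (u : Fin (n + 1) → Fin (m + 1)) :
    pos i u = if (u (Fin.last n)).val = i then pos i (front u) + 2 ^ n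
      else if (u (Fin.last n)).val = i + 1 then pos i (front u)
      else if (u (Fin.last n)).val < i then 2 * 2 ^ n - 1 else 0 := by
  rw [pos, pow_succ' (2 : ℤ) n]

lemma two_pow_pos' (n : ℕ) : (0 : ℤ) < 2 ^ n := by positivity

lemma pos_bounds (i : Fin m) {n : ℕ} (u : Fin n → Fin (m + 1)) :
    0 ≤ pos i u ∧ pos i u < 2 ^ n := by
  induction n with
  | zero => simp [pos]
  | succ n ih =>
    have := ih (front u)
    rw [pos_succ, pow_succ']
    have := two_pow_pos' n
    split_ifs <;> omega

lemma pos_const (i : Fin m) (n : ℕ) (a : Fin (m + 1)) :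
    pos i (fun _ : Fin n => a) = if a.val ≤ i then 2 ^ n - 1 else 0 := by
  induction n with
  | zero => simp [pos]
  | succ n ih =>
    rw [pos_succ, front_const, ih, pow_succ']
    have := two_pow_pos' n
    split_ifs <;> omega

lemma On_succ (i : Fin m) {n : ℕ} (w : Fin (n + 1) → Fin (m + 1)) :
    On i w ↔ On i (front w) ∧ Inc i (w (Fin.last n)) := forall_word w (Inc i)

lemma On_const (i : Fin m) {n : ℕ} {a : Fin (m + 1)} (h : Inc i a) :
    On i (fun _ : Fin n => a) := fun _ => h

/-- The generator of the edge `i`. -/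
def gen (i : Fin m) {n : ℕ} (w : Fin n → Fin (m + 1)) : Fin n → Fin (m + 1) :=
  odo i.castSucc i.succ w

lemma front_gen (i : Fin m) {n : ℕ} (w : Fin (n + 1) → Fin (m + 1)) :
    front (gen i w) = gen i (front w) := front_odo _ _ _

/-- The last letter of a word either stays, or the word is at the carry. -/
lemma gen_cases (i : Fin m) {n : ℕ} (w : Fin (n + 1) → Fin (m + 1)) :
    (gen i w (Fin.last n) = w (Fin.last n) ∧
        (front w ≠ (fun _ => i.castSucc) ∨ ¬ Inc i (w (Fin.last n)))) ∨
      (front w = (fun _ => i.castSucc) ∧ gen i (front w) = (fun _ => i.succ) ∧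
        ((w (Fin.last n) = i.castSucc ∧ gen i w (Fin.last n) = i.succ) ∨
          (w (Fin.last n) = i.succ ∧ gen i w (Fin.last n) = i.castSucc))) := by
  by_cases h : front w = fun _ => i.castSucc
  · have hg : gen i (front w) = fun _ => i.succ := by rw [h]; exact odo_const _ _ _
    have hl : gen i w (Fin.last n) = Equiv.swap i.castSucc i.succ (w (Fin.last n)) := by
      rw [gen, odo_last, if_pos h]
    by_cases h1 : w (Fin.last n) = i.castSucc
    · right; refine ⟨h, hg, .inl ⟨h1, ?_⟩⟩; rw [hl, h1]; simp
    · by_cases h2 : w (Fin.last n) = i.succ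
      · right; refine ⟨h, hg, .inr ⟨h2, ?_⟩⟩; rw [hl, h2]; simp
      · left
        refine ⟨by rw [hl, Equiv.swap_apply_of_ne_of_ne h1 h2], .inr ?_⟩
        rintro (h3 | h3)
        · exact h1 (Fin.ext h3)
        · exact h2 (Fin.ext h3)
  · left
    exact ⟨by rw [gen, odo_last, if_neg h], .inl h⟩

lemma On_gen (i : Fin m) {n : ℕ} (w : Fin n → Fin (m + 1)) : On i (gen i w) ↔ On i w := by
  induction n with
  | zero => exact ⟨fun _ t => t.elim0, fun _ t => t.elim0⟩
  | succ n ih =>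
    rw [On_succ, On_succ, front_gen, ih]
    rcases gen_cases i w with ⟨h, -⟩ | ⟨-, -, ⟨h, h'⟩ | ⟨h, h'⟩⟩
    · rw [h]
    · rw [h, h']; simp [Inc]
    · rw [h, h']; simp [Inc]

/-- At a carry, `i` and `i + 1` lie on the same side of the edge `j`, so the word stays at one joint
of the big cycle of `j`. -/
lemma pos_gen_of_ne {i j : Fin m} (hij : j ≠ i) {n : ℕ} (w : Fin n → Fin (m + 1)) :
    pos j (gen i w) = pos j w := by
  have hij' : j.val ≠ i.val := fun h => hij (Fin.ext h)
  induction n with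
  | zero => rfl
  | succ n ih =>
    rw [pos_succ, pos_succ j w, front_gen, ih]
    rcases gen_cases i w with ⟨h, -⟩ | ⟨h0, -, ⟨h, h'⟩ | ⟨h, h'⟩⟩
    · rw [h]
    all_goals
      rw [h0, h, h', pos_const]
      have := two_pow_pos' n
      simp only [Fin.val_castSucc, Fin.val_succ]
      split_ifs <;> omega

lemma pos_gen_of_on {i : Fin m} {n : ℕ} {w : Fin n → Fin (m + 1)} (hw : On i w) :
    (w = (fun _ => i.castSucc) ∧ pos i w = 2 ^ n - 1 ∧ pos i (gen i w) = 0) ∨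
      (w ≠ (fun _ => i.castSucc) ∧ pos i (gen i w) = pos i w + 1) := by
  induction n with
  | zero => left; exact ⟨Subsingleton.elim _ _, by simp [pos], rfl⟩
  | succ n ih =>
    have h2 := two_pow_pos' n
    have hf := ((On_succ i w).1 hw).1
    rw [pos_succ, pos_succ i (gen i w), front_gen, pow_succ']
    rcases gen_cases i w with ⟨h, h3 | h3⟩ | ⟨h0, h1, ⟨h, h'⟩ | ⟨h, h'⟩⟩
    · right
      refine ⟨fun h4 => h3 (by rw [h4]; rfl), ?_⟩
      rcases ih hf with h5 | h5
      · exact absurd h5.1 h3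
      · rw [h, h5.2]
        have := ((On_succ i w).1 hw).2
        unfold Inc at this
        split_ifs <;> omega
    · exact absurd ((On_succ i w).1 hw).2 h3
    · left
      refine ⟨word_ext h0 h, ?_⟩
      rw [h1, h0, h, h', pos_const, pos_const]
      simp only [Fin.val_castSucc, Fin.val_succ]
      split_ifs <;> omega
    · right
      refine ⟨fun h4 => ?_, ?_⟩
      · rw [h4] at h
        have := congrArg Fin.val h
        simp at this
      rw [h1, h0, h, h', pos_const, pos_const]
      simp only [Fin.val_castSucc, Fin.val_succ]
      split_ifs <;> omega

lemma pos_gen_of_not_on {i : Fin m} {n : ℕ} {w : Fin n → Fin (m + 1)} (hw : ¬ On i w) :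
    pos i (gen i w) = pos i w := by
  induction n with
  | zero => rfl
  | succ n ih =>
    rw [pos_succ, pos_succ i w, front_gen]
    rcases gen_cases i w with ⟨h, -⟩ | ⟨h0, h1, h'⟩
    · rw [h]
      by_cases h3 : Inc i (w (Fin.last n))
      · rw [ih fun h4 => hw ((On_succ i w).2 ⟨h4, h3⟩)]
      · unfold Inc at h3
        split_ifs <;> omega
    · refine absurd ((On_succ i w).2 ⟨?_, ?_⟩) hw
      · rw [h0]; exact On_const i (.inl rfl)
      · rcases h' with h' | h' <;> rw [h'.1]
        · exact .inl rfl
        · exact .inr rfl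

/-- The distance of the projections to the big cycle of the edge `i`. -/
def big (i : Fin m) {n : ℕ} (u v : Fin n → Fin (m + 1)) : ℤ := cyc (2 ^ n) (pos i u) (pos i v)

lemma big_self (i : Fin m) {n : ℕ} (u : Fin n → Fin (m + 1)) : big i u u = 0 := by
  have := two_pow_pos' n
  simp [big, cyc, this.le]

lemma big_comm (i : Fin m) {n : ℕ} (u v : Fin n → Fin (m + 1)) : big i u v = big i v u :=
  cyc_comm _ _ _

lemma big_nonneg (i : Fin m) {n : ℕ} (u v : Fin n → Fin (m + 1)) : 0 ≤ big i u v := by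
  have := pos_bounds i u
  have := pos_bounds i v
  rw [big, cyc_eq]
  split_ifs <;> omega

/-- The words are joined by the generator of the edge `i`. -/
def Joined (i : Fin m) {n : ℕ} (v v' : Fin n → Fin (m + 1)) : Prop := gen i v = v' ∨ gen i v' = v

lemma Joined.symm {i : Fin m} {n : ℕ} {v v' : Fin n → Fin (m + 1)} (h : Joined i v v') :
    Joined i v' v := Or.symm h

lemma exists_gen_eq (i : Fin m) {n : ℕ} (v : Fin n → Fin (m + 1)) : ∃ v', gen i v' = v :=
  ⟨odo i.succ i.castSucc v, odo_odo _ _ _⟩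

lemma Joined.on_iff {i : Fin m} {n : ℕ} {v v' : Fin n → Fin (m + 1)} (h : Joined i v v') :
    On i v ↔ On i v' := by
  rcases h with rfl | rfl
  · exact (On_gen i v).symm
  · exact On_gen i v'

lemma Joined.pos_eq {i : Fin m} {n : ℕ} {v v' : Fin n → Fin (m + 1)} (h : Joined i v v')
    {j : Fin m} (hj : On i v → j ≠ i) : pos j v' = pos j v := by
  have key : ∀ w : Fin n → Fin (m + 1), (On i w → j ≠ i) → pos j (gen i w) = pos j w := by
    intro w hw
    by_cases hji : j = i
    · subst hji; exact pos_gen_of_not_on fun h => hw h rfl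
    · exact pos_gen_of_ne hji w
  have hon := h.on_iff
  rcases h with rfl | rfl
  · exact key _ hj
  · exact (key _ fun h => hj (hon.2 h)).symm

lemma Joined.big_eq {i : Fin m} {n : ℕ} {v v' : Fin n → Fin (m + 1)} (h : Joined i v v')
    {j : Fin m} (hj : On i v → j ≠ i) (u : Fin n → Fin (m + 1)) : big j u v' = big j u v := by
  rw [big, big, h.pos_eq hj]

lemma Joined.big_le {i : Fin m} {n : ℕ} {v v' : Fin n → Fin (m + 1)} (h : Joined i v v')
    (u : Fin n → Fin (m + 1)) : big i u v' ≤ big i u v + 1 := by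
  have key : ∀ w : Fin n → Fin (m + 1),
      big i u (gen i w) ≤ big i u w + 1 ∧ big i u w ≤ big i u (gen i w) + 1 := by
    intro w
    have h1 := pos_bounds i u
    have h2 := pos_bounds i w
    by_cases hw : On i w
    · simp only [big, cyc_eq]
      rcases pos_gen_of_on hw with ⟨-, h3, h4⟩ | ⟨-, h3⟩
      · rw [h4, h3]
        constructor <;> split_ifs <;> omega
      · rw [h3]
        constructor <;> split_ifs <;> omega
    · rw [big, big, pos_gen_of_not_on hw]
      constructor <;> omega
  rcases h with rfl | rfl
  · exact (key _).1
  · exact (key _).2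

lemma exists_joined_big {i : Fin m} {n : ℕ} {u v : Fin n → Fin (m + 1)} (hv : On i v)
    (h : pos i u ≠ pos i v) : ∃ v', Joined i v v' ∧ big i u v' + 1 = big i u v := by
  obtain ⟨w, hw⟩ := exists_gen_eq i v
  have hw' : On i w := by rw [← On_gen, hw]; exact hv
  have h1 := pos_bounds i u
  have h2 := pos_bounds i v
  have h3 := pos_bounds i w
  have h4 := pos_gen_of_on hv
  have h5 := pos_gen_of_on hw'
  rw [hw] at h5
  -- One of the two neighbours of `v` on the cycle, successor or predecessor, lies on a shortest arc
  -- to `u`.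
  have : big i u (gen i v) + 1 = big i u v ∨ big i u w + 1 = big i u v := by
    simp only [big, cyc_eq]
    rcases h4 with ⟨-, h6, h7⟩ | ⟨-, h6⟩ <;> rcases h5 with ⟨-, h8, h9⟩ | ⟨-, h8⟩
    all_goals
      generalize pos i (gen i v) = p at *
      split_ifs <;> omega
  rcases this with h6 | h6
  · exact ⟨_, .inl rfl, h6⟩
  · exact ⟨w, .inr hw, h6⟩

/-- Off the big cycle of `i` no carry alters the last letter, so a move of the prefix lifts to the
word. -/
lemma Joined.append {i : Fin m} {n : ℕ} {v : Fin (n + 1) → Fin (m + 1)}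
    {w : Fin n → Fin (m + 1)} (h : Joined i (front v) w) (hv : ¬ On i v) :
    Joined i v (append w (v (Fin.last n))) := by
  have hc : ¬ On i (front v) ∨ ¬ Inc i (v (Fin.last n)) := by
    rw [On_succ] at hv; tauto
  have key : ∀ z : Fin (n + 1) → Fin (m + 1), ¬ On i (front z) ∨ ¬ Inc i (z (Fin.last n)) →
      gen i z = GraphAutomaton.append (gen i (front z)) (z (Fin.last n)) := by
    intro z hz
    apply word_ext
    · rw [front_gen, front_append]
    · rw [append_last]
      rcases gen_cases i z with ⟨h, -⟩ | ⟨h0, -, h1⟩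
      · exact h
      · exfalso
        rcases hz with hz | hz
        · apply hz; rw [h0]; exact On_const i (.inl rfl)
        · apply hz
          rcases h1 with ⟨h1, -⟩ | ⟨h1, -⟩ <;> rw [h1]
          · exact .inl rfl
          · exact .inr rfl
  have hon := h.on_iff
  rcases h with rfl | h
  · left; exact key v hc
  · right
    rw [key _ (by rwa [front_append, append_last, ← hon]), front_append, append_last, h,
      append_front_last]

/-! ### The small cycles -/

open Finset in
/-- The sum of the distances of the projections to the cycles that do not grow any more. -/
def small : {n : ℕ} → (Fin n → Fin (m + 1)) → (Fin n → Fin (m + 1)) → ℤ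
  | 0, _, _ => 0
  | n + 1, u, v =>
    if u (Fin.last n) = v (Fin.last n) then
      small (front u) (front v) +
        ∑ j with ¬ Inc j (v (Fin.last n)), big j (front u) (front v)
    else
      (small (front u) (fun _ => u (Fin.last n)) +
          ∑ j with ¬ Inc j (u (Fin.last n)), big j (front u) (fun _ => u (Fin.last n))) +
        (small (fun _ => v (Fin.last n)) (front v) +
          ∑ j with ¬ Inc j (v (Fin.last n)), big j (fun _ => v (Fin.last n)) (front v))

open Finset in
/-- The sum of the distances of the projections to the cycles of the words of length `n` that do
not grow when the letter `a` is appended. -/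
def fixed (a : Fin (m + 1)) {n : ℕ} (u v : Fin n → Fin (m + 1)) : ℤ :=
  small u v + ∑ j with ¬ Inc j a, big j u v

/-- Between different copies, a path leaves one copy to the chain of big cycles and enters the other
from it. Each copy is left at its constant word, up to moves along the cycles that are cut open,
which `fixed` ignores. -/
lemma small_succ {n : ℕ} (u v : Fin (n + 1) → Fin (m + 1)) :
    small u v =
      if u (Fin.last n) = v (Fin.last n) then fixed (v (Fin.last n)) (front u) (front v)
      else fixed (u (Fin.last n)) (front u) (fun _ => u (Fin.last n)) +
        fixed (v (Fin.last n)) (fun _ => v (Fin.last n)) (front v) := rfl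

lemma fixed_self_of (a : Fin (m + 1)) {n : ℕ} (u : Fin n → Fin (m + 1)) (h : small u u = 0) :
    fixed a u u = 0 := by
  simp [fixed, h, big_self]

lemma small_self {n : ℕ} (u : Fin n → Fin (m + 1)) : small u u = 0 := by
  induction n with
  | zero => rfl
  | succ n ih => rw [small_succ, if_pos rfl]; exact fixed_self_of _ _ (ih _)

lemma fixed_self (a : Fin (m + 1)) {n : ℕ} (u : Fin n → Fin (m + 1)) : fixed a u u = 0 :=
  fixed_self_of a u (small_self u)

lemma small_comm {n : ℕ} (u v : Fin n → Fin (m + 1)) : small u v = small v u := by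
  induction n with
  | zero => rfl
  | succ n ih =>
    have hf : ∀ (a : Fin (m + 1)) (u v : Fin n → Fin (m + 1)), fixed a u v = fixed a v u := by
      intro a u v
      simp only [fixed, ih u v, big_comm _ u v]
    rw [small_succ, small_succ]
    by_cases h : u (Fin.last n) = v (Fin.last n)
    · rw [if_pos h, if_pos h.symm, hf, h]
    · rw [if_neg h, if_neg (Ne.symm h), hf _ _ (front v), hf _ (front u), add_comm]

lemma fixed_comm (a : Fin (m + 1)) {n : ℕ} (u v : Fin n → Fin (m + 1)) :
    fixed a u v = fixed a v u := by
  simp only [fixed, small_comm u v, big_comm _ u v]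

lemma small_nonneg {n : ℕ} (u v : Fin n → Fin (m + 1)) : 0 ≤ small u v := by
  induction n with
  | zero => exact le_rfl
  | succ n ih =>
    have hf : ∀ (a : Fin (m + 1)) (u v : Fin n → Fin (m + 1)), 0 ≤ fixed a u v :=
      fun a u v => add_nonneg (ih u v) (Finset.sum_nonneg fun j _ => big_nonneg j u v)
    rw [small_succ]
    split_ifs
    · exact hf _ _ _
    · exact add_nonneg (hf _ _ _) (hf _ _ _)

/-- Constant words are on the chain of big cycles, so only the way from `u` to the chain counts. -/
lemma small_const {n : ℕ} (u : Fin n → Fin (m + 1)) (c d : Fin (m + 1)) :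
    small u (fun _ => c) = small u (fun _ => d) := by
  cases n with
  | zero => rfl
  | succ n =>
    have key : ∀ c, small u (fun _ => c) =
        fixed (u (Fin.last n)) (front u) (fun _ => u (Fin.last n)) := by
      intro c
      rw [small_succ, front_const, fixed_self, add_zero]
      split_ifs with h
      · rw [h]
      · rfl
    rw [key, key]

/-! ### Behaviour of the frozen cycles along a generator. -/

lemma Joined.fixed_eq {i : Fin m} {n : ℕ} {v v' : Fin n → Fin (m + 1)} (h : Joined i v v')
    (u : Fin n → Fin (m + 1)) (hs : small u v' = small u v) {a : Fin (m + 1)} (ha : Inc i a) :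
    fixed a u v' = fixed a u v := by
  rw [fixed, fixed, hs]
  congr 1
  refine Finset.sum_congr rfl fun j hj => h.big_eq (fun _ hji => ?_) u
  subst hji
  simp [ha] at hj

/-- Only the big cycle of `i` separates the two constant words, and `fixed a` omits it since `i` is
incident to `a`. -/
lemma fixed_const_of_inc {i : Fin m} {c a : Fin (m + 1)} (hc : Inc i c) (ha : Inc i a) {n : ℕ}
    (u : Fin n → Fin (m + 1)) : fixed a u (fun _ => c) = fixed a u (fun _ => a) := by
  rw [fixed, fixed, small_const u c a]
  congr 1
  refine Finset.sum_congr rfl fun j hj => ?_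
  simp only [Finset.mem_filter, Finset.mem_univ, true_and] at hj
  have : pos j (fun _ : Fin n => c) = pos j (fun _ : Fin n => a) := by
    rw [pos_const, pos_const]
    unfold Inc at *
    split_ifs <;> omega
  rw [big, big, this]

lemma small_gen_of_on {i : Fin m} {n : ℕ} {v : Fin n → Fin (m + 1)} (hv : On i v)
    (u : Fin n → Fin (m + 1)) : small u (gen i v) = small u v := by
  induction n with
  | zero => rfl
  | succ n ih =>
    obtain ⟨hf, ha⟩ := (On_succ i v).1 hv
    have hj : Joined i (front v) (gen i (front v)) := .inl rfl
    rcases gen_cases i v with ⟨h, -⟩ | ⟨h0, h1, h2⟩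
    · rw [small_succ, small_succ, front_gen, h, hj.fixed_eq _ (ih hf _) ha,
        hj.fixed_eq _ (ih hf _) ha]
    -- At a carry both words have a constant prefix, so they sit on the chain, and `small` sees only
    -- `u`.
    · have key : ∀ w : Fin (n + 1) → Fin (m + 1), ∀ c, front w = (fun _ => c) → Inc i c →
          Inc i (w (Fin.last n)) →
          small u w = fixed (u (Fin.last n)) (front u) (fun _ => u (Fin.last n)) := by
        intro w c h hc hw
        rw [small_succ, h, fixed_const_of_inc hc hw, fixed_const_of_inc hc hw, fixed_self,
          add_zero]
        split_ifs with h3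
        · rw [h3]
        · rfl
      rw [key v _ h0 (.inl rfl) ha, key (gen i v) i.succ (by rw [front_gen, h1]) (.inr rfl)
        ((On_succ _ _).1 ((On_gen i v).2 hv)).2]

lemma Joined.small_eq {i : Fin m} {n : ℕ} {v v' : Fin n → Fin (m + 1)} (h : Joined i v v')
    (hv : On i v) (u : Fin n → Fin (m + 1)) : small u v' = small u v := by
  have hon := h.on_iff
  rcases h with rfl | rfl
  · exact small_gen_of_on hv u
  · exact (small_gen_of_on (hon.1 hv) u).symm

open Finset in
/-- The total change along a generator is the change on the one cycle that it moves along. -/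
lemma Joined.sum_big_sub {i : Fin m} {n : ℕ} {v v' : Fin n → Fin (m + 1)} (h : Joined i v v')
    (u : Fin n → Fin (m + 1)) (p : Fin m → Prop) [DecidablePred p] (hp : p i) :
    ∑ j with p j, big j u v' = ∑ j with p j, big j u v + (big i u v' - big i u v) := by
  have hi : i ∈ univ.filter p := by simp [hp]
  rw [← Finset.add_sum_erase _ _ hi, ← Finset.add_sum_erase _ (fun j => big j u v) hi,
    Finset.sum_congr rfl fun j hj => h.big_eq (fun _ => (Finset.mem_erase.1 hj).1) u]
  ring

/-- The bound on `small` is a hypothesis so that this can serve as the induction step of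
`Joined.small_le`. -/
lemma Joined.fixed_le {i : Fin m} {n : ℕ} {v v' : Fin n → Fin (m + 1)} (h : Joined i v v')
    (u : Fin n → Fin (m + 1)) (hs : ¬ On i v → small u v' ≤ small u v + 1) (a : Fin (m + 1)) :
    fixed a u v' ≤ fixed a u v + 1 := by
  by_cases hv : On i v
  · have h1 := h.small_eq hv u
    by_cases ha : Inc i a
    · rw [h.fixed_eq u h1 ha]; omega
    · have h2 := h.sum_big_sub u (fun j => ¬ Inc j a) ha
      have h3 := h.big_le u
      rw [fixed, fixed]
      omega
  · have h1 := hs hv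
    rw [fixed, fixed, Finset.sum_congr rfl fun j _ => h.big_eq (fun h => absurd h hv) u]
    omega

lemma Joined.of_not_on {i : Fin m} {n : ℕ} {v v' : Fin (n + 1) → Fin (m + 1)}
    (h : Joined i v v') (hv : ¬ On i v) :
    Joined i (front v) (front v') ∧ v' (Fin.last n) = v (Fin.last n) := by
  have key : ∀ w : Fin (n + 1) → Fin (m + 1), ¬ On i w →
      gen i w (Fin.last n) = w (Fin.last n) := by
    intro w hw
    rcases gen_cases i w with ⟨h, -⟩ | ⟨h0, h1, h2⟩
    · exact h
    · refine absurd ((On_succ i w).2 ⟨?_, ?_⟩) hw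
      · rw [h0]; exact On_const i (.inl rfl)
      · rcases h2 with h2 | h2 <;> rw [h2.1]
        · exact .inl rfl
        · exact .inr rfl
  have hon := h.on_iff
  rcases h with rfl | rfl
  · exact ⟨.inl (front_gen i v).symm, key v hv⟩
  · exact ⟨.inr (front_gen i v').symm, (key v' (fun h => hv (hon.2 h))).symm⟩

lemma Joined.small_le {i : Fin m} {n : ℕ} {v v' : Fin n → Fin (m + 1)} (h : Joined i v v')
    (hv : ¬ On i v) (u : Fin n → Fin (m + 1)) : small u v' ≤ small u v + 1 := by
  induction n with
  | zero => exact absurd (fun t => t.elim0) hv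
  | succ n ih =>
    obtain ⟨h1, h2⟩ := h.of_not_on hv
    rw [small_succ, small_succ, h2]
    split_ifs
    · exact h1.fixed_le _ (fun h3 => ih h1 h3 _) _
    · rw [add_assoc]
      exact add_le_add_right (h1.fixed_le _ (fun h3 => ih h1 h3 _) _) _

/-- The sum over all cycles of the distances of the projections. -/
def total {n : ℕ} (u v : Fin n → Fin (m + 1)) : ℤ := small u v + ∑ j, big j u v

lemma Joined.total_le {i : Fin m} {n : ℕ} {v v' : Fin n → Fin (m + 1)} (h : Joined i v v')
    (u : Fin n → Fin (m + 1)) : total u v' ≤ total u v + 1 := by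
  rw [total, total]
  by_cases hv : On i v
  · have h1 := h.small_eq hv u
    have h2 := h.sum_big_sub u (fun _ => True) trivial
    simp only [Finset.filter_true] at h2
    have h3 := h.big_le u
    omega
  · have h1 := h.small_le hv u
    rw [Finset.sum_congr rfl fun j _ => h.big_eq (fun h => absurd h hv) u]
    omega

/-- Along the edge `i` one can get from `v` closer to `u`. -/
def Descent (i : Fin m) {n : ℕ} (u v : Fin n → Fin (m + 1)) : Prop :=
  (On i v ∧ pos i u ≠ pos i v) ∨
    (¬ On i v ∧ ∃ v', Joined i v v' ∧ small u v' + 1 = small u v)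

lemma Descent.exists_fixed {i : Fin m} {n : ℕ} {u v : Fin n → Fin (m + 1)} (h : Descent i u v)
    {a : Fin (m + 1)} (ha : On i v → ¬ Inc i a) :
    ∃ v', Joined i v v' ∧ fixed a u v' + 1 = fixed a u v := by
  rcases h with ⟨hv, h⟩ | ⟨hv, v', hj, h⟩
  · obtain ⟨v', hj, h1⟩ := exists_joined_big hv h
    refine ⟨v', hj, ?_⟩
    have h2 := hj.sum_big_sub u (fun j => ¬ Inc j a) (ha hv)
    have h3 := hj.small_eq hv u
    rw [fixed, fixed]
    omega
  · refine ⟨v', hj, ?_⟩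
    rw [fixed, fixed, Finset.sum_congr rfl fun j _ => hj.big_eq (fun h => absurd h hv) u]
    omega

/-- Induction on the length: the prefix of `v` descends towards the prefix of `u` if the last
letters agree, and otherwise towards the exit of its copy, the constant word of its own last letter.
-/
lemma exists_descent {n : ℕ} {u v : Fin n → Fin (m + 1)} (huv : u ≠ v) :
    ∃ i, Descent i u v := by
  induction n with
  | zero => exact absurd (Subsingleton.elim _ _) huv
  | succ n ih =>
    have h2 := two_pow_pos' n
    by_cases hl : u (Fin.last n) = v (Fin.last n)
    · obtain ⟨i, hi⟩ := ih (u := front u) (v := front v) fun h => huv (word_ext h hl)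
      refine ⟨i, ?_⟩
      by_cases hv : On i v
      · left
        refine ⟨hv, ?_⟩
        obtain ⟨hf, ha⟩ := (On_succ i v).1 hv
        rcases hi with ⟨-, hi⟩ | ⟨hi, -⟩
        · rw [pos_succ, pos_succ i v, hl]
          unfold Inc at ha
          split_ifs <;> omega
        · exact absurd hf hi
      · right
        refine ⟨hv, ?_⟩
        obtain ⟨w, hw, h⟩ := hi.exists_fixed (a := v (Fin.last n)) fun h h' =>
          hv ((On_succ i v).2 ⟨h, h'⟩)
        refine ⟨_, hw.append hv, ?_⟩
        rw [small_succ, small_succ, append_last, front_append, if_pos hl, if_pos hl, h]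
    · have hl' : (u (Fin.last n)).val ≠ (v (Fin.last n)).val := fun h => hl (Fin.ext h)
      by_cases hc : front v = fun _ => v (Fin.last n)
      -- Here `v` is a constant word, a joint of the chain; the edge taken is the one at its letter
      -- on the side of the last letter of `u`.
      · have : ∃ i : Fin m, Inc i (v (Fin.last n)) ∧
            (((u (Fin.last n)).val ≤ i ∧ (v (Fin.last n)).val = i + 1) ∨
              ((v (Fin.last n)).val = i ∧ i + 1 ≤ (u (Fin.last n)).val)) := by
          have h3 := (u (Fin.last n)).2
          have h4 := (v (Fin.last n)).2
          rcases lt_or_gt_of_ne hl' with h | h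
          · exact ⟨⟨(v (Fin.last n)).val - 1, by omega⟩, .inr (by simp; omega),
              .inl ⟨by simp; omega, by simp; omega⟩⟩
          · exact ⟨⟨(v (Fin.last n)).val, by omega⟩, .inl rfl, .inr ⟨rfl, by simp; omega⟩⟩
        obtain ⟨i, hi, h⟩ := this
        refine ⟨i, .inl ⟨(On_succ i v).2 ⟨by rw [hc]; exact On_const i hi, hi⟩, ?_⟩⟩
        rw [pos_succ, pos_succ i v, hc, pos_const]
        have := pos_bounds i (front u)
        split_ifs <;> omega
      · obtain ⟨i, hi⟩ := ih (Ne.symm hc)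
        refine ⟨i, ?_⟩
        by_cases hv : On i v
        · left
          refine ⟨hv, ?_⟩
          obtain ⟨hf, ha⟩ := (On_succ i v).1 hv
          rcases hi with ⟨-, hi⟩ | ⟨hi, -⟩
          -- The copy of `v` holds half of the doubled cycle. As the prefix of `v` is not at the
          -- joint, `v` differs both from the projection of any word in the other half and from the
          -- joint that remains outside.
          · rw [pos_const] at hi
            rw [pos_succ, pos_succ i v]
            have := pos_bounds i (front u)
            have := pos_bounds i (front v)
            unfold Inc at ha
            split_ifs at hi ⊢ <;> omega
          · exact absurd hf hi
        · right
          refine ⟨hv, ?_⟩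
          obtain ⟨w, hw, h⟩ := hi.exists_fixed (a := v (Fin.last n)) fun h h' =>
            hv ((On_succ i v).2 ⟨h, h'⟩)
          refine ⟨_, hw.append hv, ?_⟩
          rw [small_succ, small_succ, append_last, front_append, if_neg hl, if_neg hl, ← h]
          ring

lemma exists_joined_total {n : ℕ} {u v : Fin n → Fin (m + 1)} (huv : u ≠ v) :
    ∃ i v', Joined i v v' ∧ total u v' + 1 = total u v := by
  obtain ⟨i, ⟨hv, h⟩ | ⟨hv, v', hj, h⟩⟩ := exists_descent huv
  · obtain ⟨v', hj, h1⟩ := exists_joined_big hv h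
    refine ⟨i, v', hj, ?_⟩
    have h2 := hj.sum_big_sub u (fun _ => True) trivial
    simp only [Finset.filter_true] at h2
    have h3 := hj.small_eq hv u
    rw [total, total]
    omega
  · refine ⟨i, v', hj, ?_⟩
    rw [total, total, Finset.sum_congr rfl fun j _ => hj.big_eq (fun h => absurd h hv) u]
    omega

lemma total_self {n : ℕ} (u : Fin n → Fin (m + 1)) : total u u = 0 := by
  simp [total, small_self, big_self]

lemma total_nonneg {n : ℕ} (u v : Fin n → Fin (m + 1)) : 0 ≤ total u v :=
  add_nonneg (small_nonneg u v) (Finset.sum_nonneg fun j _ => big_nonneg j u v)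

end BigCycle


/-! ### The sum of the distances -/

section Sums

variable {m : ℕ}

lemma sum_letters (i : Fin m) (c₁ c₂ c₃ c₄ : ℤ) :
    ∑ a : Fin (m + 1), (if a.val = i then c₁ else if a.val = i + 1 then c₂
      else if a.val < i then c₃ else c₄) = c₁ + c₂ + i * c₃ + (m - 1 - i) * c₄ := by
  obtain ⟨i, hi⟩ := i
  simp only
  rw [Fin.sum_univ_eq_sum_range (fun a => if a = i then c₁ else if a = i + 1 then c₂
      else if a < i then c₃ else c₄) (m + 1)]
  induction m, hi using Nat.le_induction with
  | base =>
    rw [Finset.sum_range_succ, Finset.sum_range_succ, Finset.sum_congr rfl (g := fun _ => c₃)]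
    · simp; ring
    · intro a ha
      have := Finset.mem_range.1 ha
      rw [if_neg (by omega), if_neg (by omega), if_pos this]
  | succ m hm ih =>
    rw [Finset.sum_range_succ, ih, if_neg (by omega), if_neg (by omega), if_neg (by omega)]
    push_cast; ring

lemma sum_cyc_pos (i : Fin m) (n : ℕ) (q : ℤ) (h0 : 0 ≤ q) (hq : q < 2 * 2 ^ n) :
    ∑ u : Fin (n + 1) → Fin (m + 1), cyc (2 ^ (n + 1)) (pos i u) q =
      (m + 1) ^ n * (2 ^ n + i * cyc (2 ^ (n + 1)) (2 * 2 ^ n - 1) q +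
        (m - 1 - i) * cyc (2 ^ (n + 1)) 0 q) := by
  rw [sum_word]
  have : ∀ w : Fin n → Fin (m + 1),
      ∑ a, cyc (2 ^ (n + 1)) (pos i (append w a)) q =
        2 ^ n + i * cyc (2 ^ (n + 1)) (2 * 2 ^ n - 1) q +
          (m - 1 - i) * cyc (2 ^ (n + 1)) 0 q := by
    intro w
    have h1 : ∀ a, cyc (2 ^ (n + 1)) (pos i (append w a)) q =
        if a.val = i then cyc (2 ^ (n + 1)) (pos i w + 2 ^ n) q
        else if a.val = i + 1 then cyc (2 ^ (n + 1)) (pos i w) q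
        else if a.val < i then cyc (2 ^ (n + 1)) (2 * 2 ^ n - 1) q
        else cyc (2 ^ (n + 1)) 0 q := by
      intro a
      rw [pos_succ, append_last, front_append]
      split_ifs <;> rfl
    -- The two positions are antipodal, so the sum depends neither on `w` nor on `q`.
    have h2 : cyc (2 ^ (n + 1)) (pos i w + 2 ^ n) q + cyc (2 ^ (n + 1)) (pos i w) q = 2 ^ n := by
      have := pos_bounds i w
      rw [cyc_eq, cyc_eq, pow_succ']
      split_ifs <;> omega
    rw [Finset.sum_congr rfl fun a _ => h1 a, sum_letters, h2]
  rw [Finset.sum_congr rfl fun w _ => this w]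
  simp

lemma sum_big_const (i : Fin m) (n : ℕ) (a : Fin (m + 1)) :
    ∑ u : Fin (n + 1) → Fin (m + 1), big i u (fun _ => a) =
      (m + 1) ^ n * (2 ^ n + if a.val ≤ i then (m - 1 - i : ℤ) else i) := by
  have h2 := two_pow_pos' n
  have h1 := sum_cyc_pos i n (pos i (fun _ : Fin (n + 1) => a)) (pos_bounds _ _).1
    (by rw [← pow_succ']; exact (pos_bounds _ _).2)
  have c1 : cyc (2 ^ (n + 1)) (2 * 2 ^ n - 1) (2 ^ (n + 1) - 1) = 0 := by
    rw [cyc_eq, pow_succ']; split_ifs <;> omega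
  have c2 : cyc (2 ^ (n + 1)) 0 (2 ^ (n + 1) - 1) = 1 := by
    rw [cyc_eq, pow_succ']; split_ifs <;> omega
  have c3 : cyc (2 ^ (n + 1)) (2 * 2 ^ n - 1) 0 = 1 := by
    rw [cyc_eq, pow_succ']; split_ifs <;> omega
  have c4 : cyc (2 ^ (n + 1)) 0 0 = 0 := by
    rw [cyc_eq, pow_succ']; split_ifs <;> omega
  simp only [big]
  rw [h1, pos_const]
  split_ifs
  · rw [c1, c2]; ring
  · rw [c3, c4]; ring

/-- Two rounds of averaging: summing over `u` leaves only the distances from `v` to the two joints,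
and these are summed over `v` by `sum_big_const`. -/
lemma sum_big (i : Fin m) (n : ℕ) :
    ∑ v : Fin (n + 1) → Fin (m + 1), ∑ u, big i u v =
      ((m + 1) ^ n * (m + 1) ^ n : ℤ) * (2 * 2 ^ n * m + 2 * (i * (m - 1 - i))) := by
  have h1 : ∀ v : Fin (n + 1) → Fin (m + 1), ∑ u, big i u v =
      (m + 1) ^ n * (2 ^ n + i * big i v (fun _ => i.castSucc) +
        (m - 1 - i) * big i v (fun _ => i.succ)) := by
    intro v
    have := sum_cyc_pos i n (pos i v) (pos_bounds _ _).1
      (by rw [← pow_succ']; exact (pos_bounds _ _).2)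
    simp only [big]
    rw [this, pos_const, pos_const, cyc_comm _ _ (pos i v), cyc_comm _ _ (pos i v)]
    simp only [Fin.val_castSucc, Fin.val_succ, le_refl, if_true]
    rw [if_neg (by omega), pow_succ']
  rw [Finset.sum_congr rfl fun v _ => h1 v, ← Finset.mul_sum, Finset.sum_add_distrib,
    Finset.sum_add_distrib, ← Finset.mul_sum, ← Finset.mul_sum, sum_big_const, sum_big_const]
  simp only [Fin.val_castSucc, Fin.val_succ, le_refl, if_true]
  rw [if_neg (by omega)]
  simp
  ring

/-- The sum over the edges of the products of the numbers of letters on either side. -/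
def sideSum (m : ℕ) : ℤ := ∑ i : Fin m, (i : ℤ) * (m - 1 - i)

lemma six_mul_sideSum (m : ℕ) : 6 * sideSum m = m * (m - 1) * (m - 2) := by
  -- The constant `c` is decoupled from the range, since `m` also occurs in the summand.
  have h : ∀ n : ℕ, ∀ c : ℤ, 6 * ∑ i ∈ Finset.range n, (i : ℤ) * (c - i) =
      n * (n - 1) * (3 * c - 2 * n + 1) := by
    intro n c
    induction n with
    | zero => simp
    | succ n ih =>
      rw [Finset.sum_range_succ, mul_add, ih]
      push_cast; ring
  rw [sideSum, Fin.sum_univ_eq_sum_range (fun i => (i : ℤ) * (m - 1 - i)) m, h]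
  ring

lemma sum_sum_ite (X Y Z : Fin (m + 1) → ℤ) :
    ∑ b, ∑ a, (if b = a then X a else Y b + Z a) =
      ∑ a, X a + m * ∑ a, Y a + m * ∑ a, Z a := by
  have : ∀ b a, (if b = a then X a else Y b + Z a) =
      Y b + Z a + if b = a then X a - Y a - Z a else 0 := by
    intro b a
    split_ifs with h
    · rw [h]; ring
    · ring
  simp only [this, Finset.sum_add_distrib, Finset.sum_ite_eq, Finset.mem_univ, if_true,
    Finset.sum_sub_distrib, Finset.sum_const, Finset.card_univ, Fintype.card_fin, nsmul_eq_mul,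
    ← Finset.mul_sum]
  push_cast; ring

/-- The sum of the distances along the small cycles. -/
def smallSum (m n : ℕ) : ℤ := ∑ u : Fin n → Fin (m + 1), ∑ v, small u v

/-- The sum of the distances along the big cycles. -/
def bigSum (m n : ℕ) : ℤ := ∑ i : Fin m, ∑ v : Fin n → Fin (m + 1), ∑ u, big i u v

/-- The sum over `a` and `u` of the distances of `u a` from the big cycles. -/
def rootSum (m n : ℕ) : ℤ :=
  ∑ a : Fin (m + 1), ∑ u : Fin n → Fin (m + 1), fixed a u (fun _ => a)

/-! ### Recurrences for the three sums. -/

lemma bigSum_zero (m : ℕ) : bigSum m 0 = 0 := by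
  simp [bigSum, big, pos, cyc]

lemma bigSum_succ (m n : ℕ) :
    bigSum m (n + 1) = (m + 1) ^ n * (m + 1) ^ n * (2 * 2 ^ n * m * m + 2 * sideSum m) := by
  rw [bigSum, Finset.sum_congr rfl fun i _ => sum_big i n, ← Finset.mul_sum,
    Finset.sum_add_distrib, ← Finset.mul_sum, ← Finset.mul_sum, ← sideSum]
  simp only [Finset.sum_const, Finset.card_univ, Fintype.card_fin, nsmul_eq_mul]
  ring

lemma rootSum_zero (m : ℕ) : rootSum m 0 = 0 := by
  simp [rootSum, fixed, small, big, pos, cyc]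

lemma sum_not_inc (i : Fin m) (c d : ℤ) :
    (∑ a : Fin (m + 1), if ¬ Inc i a then (if a.val ≤ i then c else d) else 0) =
      i * c + (m - 1 - i) * d := by
  have := sum_letters i 0 0 c d
  rw [zero_add, zero_add] at this
  rw [← this]
  refine Finset.sum_congr rfl fun a _ => ?_
  unfold Inc
  split_ifs <;> first | rfl | omega

lemma rootSum_succ (m n : ℕ) :
    rootSum m (n + 1) = (m + 1) * rootSum m n +
      (m + 1) ^ n * (m * (m - 1) * 2 ^ n + 2 * sideSum m) := by
  -- By `small_const`, the constant word may be changed to that of the last letter of `u`, which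
  -- leaves the root distance one level down.
  have h1 : ∀ a : Fin (m + 1), ∑ u : Fin (n + 1) → Fin (m + 1), small u (fun _ => a) =
      rootSum m n := by
    intro a
    rw [sum_word, Finset.sum_comm]
    refine Finset.sum_congr rfl fun b _ => Finset.sum_congr rfl fun w _ => ?_
    rw [small_const _ a b, small_succ, append_last, front_append, if_pos rfl, front_const]
  have h2 : ∑ a : Fin (m + 1), ∑ u : Fin (n + 1) → Fin (m + 1),
      ∑ j with ¬ Inc j a, big j u (fun _ => a) =
        (m + 1) ^ n * (m * (m - 1) * 2 ^ n + 2 * sideSum m) := by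
    have h3 : ∀ a : Fin (m + 1), ∑ u : Fin (n + 1) → Fin (m + 1),
        ∑ j with ¬ Inc j a, big j u (fun _ => a) = ∑ j : Fin m, if ¬ Inc j a then
          (if a.val ≤ j then (m + 1) ^ n * (2 ^ n + (m - 1 - j : ℤ))
            else (m + 1) ^ n * (2 ^ n + j)) else 0 := by
      intro a
      rw [Finset.sum_comm, Finset.sum_filter]
      refine Finset.sum_congr rfl fun j _ => ?_
      rw [sum_big_const]
      split_ifs <;> rfl
    rw [Finset.sum_congr rfl fun a _ => h3 a, Finset.sum_comm,
      Finset.sum_congr rfl fun j _ => sum_not_inc j _ _]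
    have h4 : ∀ j : Fin m, (j : ℤ) * ((m + 1) ^ n * (2 ^ n + (m - 1 - j : ℤ))) +
        (m - 1 - j) * ((m + 1) ^ n * (2 ^ n + j)) =
          (m + 1) ^ n * ((m - 1) * 2 ^ n + 2 * (j * (m - 1 - j))) := fun j => by ring
    rw [Finset.sum_congr rfl fun j _ => h4 j, ← Finset.mul_sum, Finset.sum_add_distrib,
      ← Finset.mul_sum, ← Finset.mul_sum, ← sideSum]
    simp only [Finset.sum_const, Finset.card_univ, Fintype.card_fin, nsmul_eq_mul]
    ring
  have h5 : rootSum m (n + 1) = ∑ a : Fin (m + 1),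
      (∑ u : Fin (n + 1) → Fin (m + 1), small u (fun _ => a) +
        ∑ u : Fin (n + 1) → Fin (m + 1), ∑ j with ¬ Inc j a, big j u (fun _ => a)) := by
    simp only [rootSum, fixed, Finset.sum_add_distrib]
  rw [h5, Finset.sum_add_distrib, h2, Finset.sum_congr rfl fun a _ => h1 a]
  simp

lemma sum_fixed (m n : ℕ) :
    ∑ a : Fin (m + 1), ∑ u : Fin n → Fin (m + 1), ∑ v, fixed a u v =
      (m + 1) * smallSum m n + (m - 1) * bigSum m n := by
  simp only [fixed, Finset.sum_add_distrib]
  congr 1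
  · simp [smallSum]
  · have h1 : ∀ a : Fin (m + 1), ∑ u : Fin n → Fin (m + 1), ∑ v : Fin n → Fin (m + 1),
        ∑ j with ¬ Inc j a, big j u v = ∑ j : Fin m, if ¬ Inc j a then
          (if a.val ≤ j then ∑ v : Fin n → Fin (m + 1), ∑ u, big j u v
            else ∑ v : Fin n → Fin (m + 1), ∑ u, big j u v) else 0 := by
      intro a
      rw [Finset.sum_comm]
      simp only [ite_self, Finset.sum_filter]
      rw [Finset.sum_congr rfl fun v _ => Finset.sum_comm, Finset.sum_comm]
      refine Finset.sum_congr rfl fun j _ => ?_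
      split_ifs <;> simp
    rw [Finset.sum_congr rfl fun a _ => h1 a, Finset.sum_comm,
      Finset.sum_congr rfl fun j _ => sum_not_inc j _ _, bigSum, Finset.mul_sum]
    refine Finset.sum_congr rfl fun j _ => ?_
    ring

/-- Pairs in one copy give `sum_fixed`, where each edge misses `m - 1` letters. For different copies
the two root distances separate: each has `m` choices of the other letter and `(m + 1) ^ n` of the
other prefix. -/
lemma smallSum_succ (m n : ℕ) :
    smallSum m (n + 1) = (m + 1) * smallSum m n + (m - 1) * bigSum m n +
      2 * m * (m + 1) ^ n * rootSum m n := by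
  have h1 : smallSum m (n + 1) = ∑ u : Fin n → Fin (m + 1), ∑ v : Fin n → Fin (m + 1),
      ∑ b, ∑ a, if b = a then fixed a u v
        else fixed b u (fun _ => b) + fixed a v (fun _ => a) := by
    rw [smallSum, sum_word]
    refine Finset.sum_congr rfl fun u _ => ?_
    rw [Finset.sum_congr rfl fun b _ => sum_word _, Finset.sum_comm]
    refine Finset.sum_congr rfl fun v _ => Finset.sum_congr rfl fun b _ =>
      Finset.sum_congr rfl fun a _ => ?_
    rw [small_succ]
    simp only [append_last, front_append]
    rw [fixed_comm a v]
  have h2 : ∑ u : Fin n → Fin (m + 1), ∑ a, fixed a u (fun _ => a) = rootSum m n := by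
    rw [Finset.sum_comm]; rfl
  rw [h1, ← sum_fixed]
  simp only [sum_sum_ite, Finset.sum_add_distrib, ← Finset.mul_sum, h2]
  have h3 : ∑ u : Fin n → Fin (m + 1), ∑ v : Fin n → Fin (m + 1), ∑ a, fixed a u v =
      ∑ a, ∑ u : Fin n → Fin (m + 1), ∑ v, fixed a u v := by
    rw [Finset.sum_congr rfl fun u _ => Finset.sum_comm, Finset.sum_comm]
  rw [h3]
  simp [← Finset.mul_sum, h2]
  ring

lemma sum_total (m n : ℕ) :
    ∑ u : Fin n → Fin (m + 1), ∑ v, total u v = smallSum m n + bigSum m n := by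
  simp only [total, Finset.sum_add_distrib]
  congr 1
  rw [Finset.sum_comm, Finset.sum_congr rfl fun v _ => Finset.sum_comm, Finset.sum_comm]
  rfl

/-! ### Solution of the recurrences. -/

lemma rootSum_eq (m n : ℕ) :
    (m + 1) * rootSum m n =
      (m + 1) ^ n * (m * (m - 1) * (2 ^ n - 1) + 2 * n * sideSum m) := by
  induction n with
  | zero => simp [rootSum_zero]
  | succ n ih =>
    rw [rootSum_succ, mul_add, ih]
    push_cast; ring

lemma smallSum_one (m : ℕ) : smallSum m 1 = 0 := by
  rw [smallSum_succ, bigSum_zero, rootSum_zero]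
  simp [smallSum, small]

lemma smallSum_succ_succ (m n : ℕ) :
    smallSum m (n + 2) = (m + 1) * smallSum m (n + 1) +
      (m - 1) * ((m + 1) ^ n * (m + 1) ^ n * (2 * 2 ^ n * m * m + 2 * sideSum m)) +
      2 * m * (m + 1) ^ n * ((m + 1) ^ n * (m + 1) *
        (m * (m - 1) * (2 * 2 ^ n - 1) + 2 * (n + 1) * sideSum m)) := by
  rw [smallSum_succ m (n + 1), bigSum_succ]
  have := rootSum_eq m (n + 1)
  have h : 2 * (m : ℤ) * (m + 1) ^ (n + 1) * rootSum m (n + 1) =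
      2 * m * (m + 1) ^ n * ((m + 1) * rootSum m (n + 1)) := by ring
  rw [h, this]
  push_cast; ring

/-- The Wiener index in the closed form. -/
def closedForm (k : ℚ) (n : ℕ) : ℚ :=
  (k - 1) ^ 2 * (2 * k ^ 2 - 2 * k - 1) / (k ^ 3 * (2 * k - 1)) * (2 ^ n * k ^ (2 * n))
    + (k - 1) * (k - 2) * (k - 3) / (3 * k ^ 2) * (n * k ^ (2 * n))
    - (k + 1) * (k - 2) * (k ^ 2 + 2 * k - 6) / (6 * k ^ 3) * k ^ (2 * n)
    + (k + 1) * (k - 2) * (2 * k - 5) / (6 * k * (2 * k - 1)) * k ^ n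

lemma smallSum_add_bigSum (m n : ℕ) :
    (1 / 2 : ℚ) * ((smallSum m (n + 1) + bigSum m (n + 1) : ℤ) : ℚ) =
      closedForm (m + 1) (n + 1) := by
  have hk : (m + 1 : ℚ) ≠ 0 := by positivity
  have hk2 : (2 * (m + 1) - 1 : ℚ) ≠ 0 := by
    have : (0 : ℚ) ≤ m := by positivity
    linarith
  have hG : (sideSum m : ℚ) = m * (m - 1) * (m - 2) / 6 := by
    have := six_mul_sideSum m
    have : (6 * sideSum m : ℚ) = m * (m - 1) * (m - 2) := by exact_mod_cast this
    linarith
  have hm : (m : ℚ) = (m + 1) - 1 := by ring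
  -- The induction starts at word length 1. At length 0 the formula fails (it gives `1 / 8` for `k =
  -- 2`), because the antipodal argument needs cycles of even length.
  induction n with
  | zero =>
    rw [smallSum_one, bigSum_succ, closedForm]
    push_cast
    rw [hG]
    generalize (m + 1 : ℚ) = k at *
    rw [hm]
    field_simp
    ring
  | succ n ih =>
    rw [bigSum_succ] at ih ⊢
    rw [smallSum_succ_succ]
    have ih' : (smallSum m (n + 1) : ℚ) = 2 * closedForm (m + 1) (n + 1) -
        (m + 1) ^ n * (m + 1) ^ n * (2 * 2 ^ n * m * m + 2 * sideSum m) := by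
      push_cast at ih
      linarith
    push_cast
    rw [ih', hG]
    unfold closedForm
    push_cast
    generalize (m + 1 : ℚ) = k at *
    rw [hm]
    have e1 : k ^ (2 * (n + 1)) = k ^ n * k ^ n * k ^ 2 := by ring
    have e2 : k ^ (2 * (n + 1 + 1)) = k ^ n * k ^ n * k ^ 4 := by ring
    have e3 : k ^ (n + 1 + 1) = k ^ n * k ^ 2 := by ring
    have e4 : (2 : ℚ) ^ (n + 1 + 1) = 2 ^ n * 4 := by ring
    rw [e1, e2, e3, e4, pow_succ k n, pow_succ 2 n]
    -- With the powers and `n` as independent variables, the claim is an identity of rational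
    -- functions.
    generalize k ^ n = a
    generalize (2 : ℚ) ^ n = b
    generalize (n : ℚ) = c
    field_simp
    ring

end Sums

/-! ### The Schreier graphs -/

section Schreier

variable {V : Type*} {G : SimpleGraph V} {m : ℕ}

/-- An arc acts as the generator of its edge or as the inverse, according to its direction; `Joined`
is symmetric and covers both. -/
lemma schreierGraph_adj (o : EdgeOrientation G) (φ : G ≃g SimpleGraph.pathGraph (m + 1)) {n : ℕ}
    (u v : Fin n → V) : ((graphAutomaton o).schreierGraph n).Adj u v ↔
      u ≠ v ∧ ∃ i : Fin m, Joined i (φ ∘ u) (φ ∘ v) := by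
  classical
  rw [Automaton.schreierGraph, SimpleGraph.fromRel_adj]
  refine and_congr_right fun huv => ⟨?_, ?_⟩
  · have key : ∀ u v : Fin n → V, u ≠ v → (∃ q, (graphAutomaton o).act q u = v) →
        ∃ i : Fin m, Joined i (φ ∘ u) (φ ∘ v) := by
      rintro u v huv ⟨_ | e, rfl⟩
      · rw [act_none] at huv; exact absurd rfl huv
      · have hc : φ ∘ odo e.1.1 e.1.2 u = odo (φ.toEquiv e.1.1) (φ.toEquiv e.1.2) (φ ∘ u) :=
          (odo_comp φ.toEquiv e.1.1 e.1.2 u).symm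
        rw [act_some, hc]
        have ha : (SimpleGraph.pathGraph (m + 1)).Adj (φ e.1.1) (φ e.1.2) :=
          φ.map_adj_iff.2 (o.adj_of_mem e.2)
        rw [SimpleGraph.pathGraph_adj] at ha
        rcases ha with ha | ha
        · refine ⟨⟨(φ e.1.1).val, by omega⟩, .inl ?_⟩
          have h1 : φ.toEquiv e.1.1 = Fin.castSucc ⟨(φ e.1.1).val, by omega⟩ := Fin.ext rfl
          have h2 : φ.toEquiv e.1.2 = Fin.succ ⟨(φ e.1.1).val, by omega⟩ := Fin.ext ha.symm
          rw [h2, h1]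
          rfl
        · refine ⟨⟨(φ e.1.2).val, by omega⟩, .inr ?_⟩
          have h1 : φ.toEquiv e.1.2 = Fin.castSucc ⟨(φ e.1.2).val, by omega⟩ := Fin.ext rfl
          have h2 : φ.toEquiv e.1.1 = Fin.succ ⟨(φ e.1.2).val, by omega⟩ := Fin.ext ha.symm
          rw [h2, h1]
          exact odo_odo _ _ _
    rintro (h | h)
    · exact key u v huv h
    · obtain ⟨i, hi⟩ := key v u huv.symm h
      exact ⟨i, hi.symm⟩
  · have key : ∀ (i : Fin m) (u v : Fin n → V), gen i (φ ∘ u) = φ ∘ v →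
        (∃ q, (graphAutomaton o).act q u = v) ∨ ∃ q, (graphAutomaton o).act q v = u := by
      intro i u v h
      have ha : G.Adj (φ.symm i.castSucc) (φ.symm i.succ) := by
        rw [φ.symm.map_adj_iff, SimpleGraph.pathGraph_adj]
        left; simp
      have h1 : odo (φ.symm i.castSucc) (φ.symm i.succ) u = v := by
        have h2 := odo_comp φ.toEquiv (φ.symm i.castSucc) (φ.symm i.succ) u
        have e1 : φ.toEquiv (φ.symm i.castSucc) = i.castSucc := φ.apply_symm_apply _
        have e2 : φ.toEquiv (φ.symm i.succ) = i.succ := φ.apply_symm_apply _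
        rw [e1, e2] at h2
        funext t
        exact φ.injective (congrFun (h2.symm.trans h) t)
      rcases (o.xor_of_adj ha).or with h3 | h3
      · left
        exact ⟨some ⟨_, h3⟩, by rw [act_some]; exact h1⟩
      · right
        exact ⟨some ⟨_, h3⟩, by rw [act_some, ← h1]; exact odo_odo _ _ _⟩
    rintro ⟨i, h | h⟩
    · exact key i u v h
    · exact (key i v u h).symm

lemma schreierGraph_connected_and_dist (o : EdgeOrientation G)
    (φ : G ≃g SimpleGraph.pathGraph (m + 1)) (n : ℕ) :
    ((graphAutomaton o).schreierGraph n).Connected ∧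
      ∀ u v, (((graphAutomaton o).schreierGraph n).dist u v : ℤ) = total (φ ∘ u) (φ ∘ v) := by
  have : Nonempty (Fin n → V) := ⟨fun _ => φ.symm 0⟩
  refine connected_and_dist_eq _ (fun u v => total (φ ∘ u) (φ ∘ v)) (fun u => total_self _)
    (fun u v => total_nonneg _ _) ?_ ?_
  · intro u v v' h
    obtain ⟨-, i, hi⟩ := (schreierGraph_adj o φ v v').1 h
    exact hi.total_le _
  · intro u v huv
    obtain ⟨i, w, hw, h⟩ := exists_joined_total (u := φ ∘ u) (v := φ ∘ v)
      fun h => huv (funext fun t => φ.injective (congrFun h t))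
    have hφ : φ ∘ (φ.symm ∘ w) = w := funext fun t => φ.apply_symm_apply _
    refine ⟨φ.symm ∘ w, (schreierGraph_adj o φ _ _).2 ⟨?_, i, by rwa [hφ]⟩, by rwa [hφ]⟩
    rintro rfl
    rw [hφ] at h
    omega

lemma wienerIndex_schreierGraph [Fintype V] (o : EdgeOrientation G)
    (φ : G ≃g SimpleGraph.pathGraph (m + 1)) (n : ℕ) :
    wienerIndex ((graphAutomaton o).schreierGraph n) =
      1 / 2 * ((smallSum m n + bigSum m n : ℤ) : ℚ) := by
  rw [wienerIndex, ← sum_total]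
  congr 1
  have h1 : ((∑ v, totalDist ((graphAutomaton o).schreierGraph n) v : ℕ) : ℤ) =
      ∑ u : Fin n → Fin (m + 1), ∑ v, total u v := by
    push_cast
    refine Fintype.sum_equiv (Equiv.arrowCongr (Equiv.refl _) φ.toEquiv) _ _ fun u => ?_
    rw [totalDist]
    push_cast
    refine Fintype.sum_equiv (Equiv.arrowCongr (Equiv.refl _) φ.toEquiv) _ _ fun v => ?_
    exact (schreierGraph_connected_and_dist o φ n).2 u v
  rw [← h1]
  push_cast
  rfl

end Schreier

end GraphAutomaton

theorem mainTheorem10 {V : Type*} [Fintype V] (G : SimpleGraph V) (o : GraphAutomaton.EdgeOrientation G)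
    (k n : ℕ) (hk : 1 ≤ k) (hn : 1 ≤ n) (hG : Nonempty (G ≃g SimpleGraph.pathGraph k)) :
    ((GraphAutomaton.graphAutomaton o).schreierGraph n).Connected ∧
    GraphAutomaton.wienerIndex ((GraphAutomaton.graphAutomaton o).schreierGraph n) =
      ((k : ℚ) - 1) ^ 2 * (2 * (k : ℚ) ^ 2 - 2 * k - 1) / ((k : ℚ) ^ 3 * (2 * k - 1))
          * (2 ^ n * (k : ℚ) ^ (2 * n))
        + ((k : ℚ) - 1) * (k - 2) * (k - 3) / (3 * (k : ℚ) ^ 2) * (n * (k : ℚ) ^ (2 * n))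
        - ((k : ℚ) + 1) * (k - 2) * ((k : ℚ) ^ 2 + 2 * k - 6) / (6 * (k : ℚ) ^ 3)
          * (k : ℚ) ^ (2 * n)
        + ((k : ℚ) + 1) * (k - 2) * (2 * k - 5) / (6 * k * (2 * k - 1)) * (k : ℚ) ^ n := by
  obtain ⟨φ⟩ := hG
  obtain ⟨m, rfl⟩ : ∃ m, k = m + 1 := ⟨k - 1, by omega⟩
  obtain ⟨n, rfl⟩ : ∃ n', n = n' + 1 := ⟨n - 1, by omega⟩
  refine ⟨(GraphAutomaton.schreierGraph_connected_and_dist o φ _).1, ?_⟩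
  rw [GraphAutomaton.wienerIndex_schreierGraph o φ, GraphAutomaton.smallSum_add_bigSum,
    GraphAutomaton.closedForm]
  push_cast
  rfl
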